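/- All groups are discrete. A function $\varphi: G\to\mathbb{R}$ on a group $G$ is called conditionally negative definite if $\varphi(e)=0$, $\varphi(g^{-1})=\varphi(g)$ for all $g\in G$, and $\sum_{i,j=1}^n c_ic_j\,\varphi(g_j^{-1}g_i)\le 0$ for all $n\in\mathbb{N}$, all $g_1,\dots,g_n\in G$ and all $c_1,\dots,c_n\in\mathbb{R}$ with $\sum_{i=1}^n c_i=0$. It is called proper if $\{g\in G:\varphi(g)\le r\}$ is finite for every $r\in\mathbb{R}$. The group $G$ has the Haagerup property (is a-T-menable) if there is a proper conditionally negative definite function on $G$. Let $\Gamma$ be a finite simple graph with vertex set $V$, and let $(G_v)_{v\in V}$ be a family of groups. The graph product $G(\Gamma)$ is the quotient of the free product $\ast_{v\in V}G_v$ by the normal subgroup generated by all commutators $[a,b]$ with $a\in G_v$, $b\in G_w$, where $v$ and $w$ are adjacent in $\Gamma$. **Theorem.** If every $G_v$ $(v\in V)$ has the Haagerup property, then the graph product $G(\Gamma)$ has the Haagerup property. -/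

import Mathlib

open Filter

universe u w

/-- A real function `φ` on a group is conditionally negative definite if it vanishes at the
identity, is symmetric, and the kernel `(x, y) ↦ φ (y⁻¹ * x)` satisfies
`∑ i, ∑ j, c i * c j * φ ((g j)⁻¹ * g i) ≤ 0` for all finite families `g` in the group and all real
coefficients `c` with sum zero. (Since `φ` is real and symmetric, complex coefficients give the
same notion; subtracting a constant from `φ` does not affect the inequality, so that `φ 1 = 0` is a
normalization.) -/
structure IsCondNegDef {G : Type*} [Group G] (φ : G → ℝ) : Prop where
  map_one : φ 1 = 0
  map_inv : ∀ g : G, φ g⁻¹ = φ g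
  sum_nonpos : ∀ (n : ℕ) (g : Fin n → G) (c : Fin n → ℝ), ∑ i, c i = 0 →
    ∑ i, ∑ j, c i * c j * φ ((g j)⁻¹ * g i) ≤ 0

/-- The Haagerup property (a-T-menability) of a discrete group: there is a proper conditionally
negative definite function on it. Properness means that every set `{g | φ g ≤ r}` is finite, that
is, `φ` tends to infinity along the complements of the finite sets. -/
def HaagerupProperty (G : Type*) [Group G] : Prop :=
  ∃ φ : G → ℝ, IsCondNegDef φ ∧ Tendsto φ cofinite atTop

/-- The relators of the graph product, in the free product of the vertex groups: the commutators
of elements of adjacent vertex groups. -/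
def graphProductRelators {V : Type w} (Γ : SimpleGraph V) (G : V → Type u) [∀ v, Group (G v)] :
    Set (Monoid.CoprodI G) :=
  {x | ∃ v w : V, Γ.Adj v w ∧ ∃ (a : G v) (b : G w),
    x = Monoid.CoprodI.of a * Monoid.CoprodI.of b *
      (Monoid.CoprodI.of a)⁻¹ * (Monoid.CoprodI.of b)⁻¹}

/-- The graph product of the groups `G v` over the graph `Γ`: the quotient of the free product of
the vertex groups by the normal closure of the relators. -/
abbrev GraphProduct {V : Type w} (Γ : SimpleGraph V) (G : V → Type u) [∀ v, Group (G v)] :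
    Type (max w u) :=
  Monoid.CoprodI G ⧸ Subgroup.normalClosure (graphProductRelators Γ G)

/-!
A conditionally negative definite function is the same thing as the squared norm `‖b g‖²` of a
cocycle `b` for an orthogonal representation, that is, of an orbit of an affine isometric action.
This is used in both directions (`IsCondNegDef.cocycle`,
`OrthogonalCocycle.isCondNegDef_sqNorm`). Only algebra is needed, so the Hilbert space is replaced
by a real vector space with a positive semidefinite symmetric form.

Fix a vertex `v` and a cocycle `b` on `G v` with values in `E`. Killing the other vertex groups
gives a retraction `proj v` of the graph product onto `G v`, and the subgroup `star v` generated by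
the groups `G w`, with `w = v` or `w` adjacent to `v`, acts on `E` through it. Inducing this
representation from `star v` yields an orthogonal representation of the graph product on the
finitely supported functions from the cosets of `star v` to `E`. It carries a unique cocycle
(`GraphProduct.cocycle`) that agrees with `b`, placed at the base coset, on `G v` and vanishes on
the other vertex groups: the affine maps attached to adjacent vertices commute because `star v`
fixes the base coset and the neighbours of `v` act trivially there.

On a word `x₁ ⋯ xₙ` in the vertex groups this cocycle is the sum of the translates of `b xᵢ` to the
cosets `x₁ ⋯ xᵢ₋₁ star v`, over the `i` with `xᵢ ∈ G v`. If the word has minimal length then these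
cosets are pairwise distinct, so that its squared norm is the sum of the squared norms of the
`b xᵢ` (`GraphProduct.IsReduced.sqNorm_cocycle`). No normal form theorem is needed for this: in a
word of minimal length, the part between two letters from `G v` contains a letter from some `G u`
with `u` outside the star of `v`, and by induction on the length the cocycle of the vertex `u` does
not vanish on that part, whereas it vanishes on `star v`.

Applying this to `φ v + 1_{g ≠ 1}`, with `φ v` proper and conditionally negative definite on `G v`,
and summing over the finitely many vertices gives a conditionally negative definite function whose
value at a minimal word is the sum of the values at its letters, each at least `1`. A bound on it
therefore bounds the length of the word and leaves finitely many letters, whence properness.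
-/

/-! ### Orthogonal cocycles -/

/-- A cocycle for an orthogonal representation of `G` on a real vector space `E`. The invariant
inner product is only required to be positive semidefinite, and `E` need not be complete. -/
structure OrthogonalCocycle (G : Type*) [Group G] (E : Type*) [AddCommGroup E] [Module ℝ E] where
  form : E →ₗ[ℝ] E →ₗ[ℝ] ℝ
  form_symm : ∀ x y, form x y = form y x
  form_nonneg : ∀ x, 0 ≤ form x x
  rep : G →* (E →ₗ[ℝ] E)
  form_rep : ∀ g x y, form (rep g x) (rep g y) = form x y
  toFun : G → E
  map_mul : ∀ g h, toFun (g * h) = toFun g + rep g (toFun h)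

namespace OrthogonalCocycle

variable {G : Type*} [Group G] {E : Type*} [AddCommGroup E] [Module ℝ E]

/-- The squared norm of the cocycle, as a function on the group. -/
def sqNorm (b : OrthogonalCocycle G E) (g : G) : ℝ := b.form (b.toFun g) (b.toFun g)

lemma sqNorm_nonneg (b : OrthogonalCocycle G E) (g : G) : 0 ≤ b.sqNorm g := b.form_nonneg _

lemma map_one (b : OrthogonalCocycle G E) : b.toFun 1 = 0 := by
  have := b.map_mul 1 1
  simpa using this

lemma rep_map_inv (b : OrthogonalCocycle G E) (g : G) : b.rep g (b.toFun g⁻¹) = -b.toFun g := by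
  have := b.map_mul g g⁻¹
  rw [mul_inv_cancel, b.map_one] at this
  exact (neg_eq_of_add_eq_zero_right this.symm).symm

lemma sqNorm_inv_mul (b : OrthogonalCocycle G E) (g h : G) :
    b.sqNorm (h⁻¹ * g) =
      b.sqNorm g + b.sqNorm h - 2 * b.form (b.toFun g) (b.toFun h) := by
  have key : b.rep h (b.toFun (h⁻¹ * g)) = b.toFun g - b.toFun h := by
    have := b.map_mul h (h⁻¹ * g)
    rw [mul_inv_cancel_left] at this
    rw [this, add_sub_cancel_left]
  rw [sqNorm, ← b.form_rep h, key]
  simp only [map_sub, LinearMap.sub_apply, b.form_symm (b.toFun h) (b.toFun g), sqNorm]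
  ring

theorem isCondNegDef_sqNorm (b : OrthogonalCocycle G E) : IsCondNegDef b.sqNorm where
  map_one := by simp [sqNorm, b.map_one]
  map_inv g := by
    rw [sqNorm, ← b.form_rep g, b.rep_map_inv]
    simp [sqNorm]
  sum_nonpos n g c hc := by
    have h1 : ∑ i, ∑ j, c i * c j * b.sqNorm ((g j)⁻¹ * g i) =
        -2 * b.form (∑ i, c i • b.toFun (g i)) (∑ i, c i • b.toFun (g i)) := by
      have h2 : ∀ i j, c i * c j * b.sqNorm ((g j)⁻¹ * g i) =
          (c i * b.sqNorm (g i)) * c j + c i * (c j * b.sqNorm (g j))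
            + -2 * (c i * (c j * b.form (b.toFun (g i)) (b.toFun (g j)))) := by
        intro i j
        rw [sqNorm_inv_mul]
        ring
      simp only [h2, Finset.sum_add_distrib, ← Finset.mul_sum, ← Finset.sum_mul, hc]
      simp only [map_sum, map_smul, LinearMap.sum_apply, LinearMap.smul_apply, smul_eq_mul,
        Finset.mul_sum, zero_mul, mul_zero, Finset.sum_const_zero, zero_add]
      exact Finset.sum_comm.trans (Finset.sum_congr rfl fun i _ => Finset.sum_congr rfl fun j _ => by
        rw [b.form_symm]; ring)
    rw [h1]
    linarith [b.form_nonneg (∑ i, c i • b.toFun (g i))]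

end OrthogonalCocycle

/-! ### Conditionally negative definite functions and their cocycles -/

namespace IsCondNegDef

lemma add {G : Type*} [Group G] {φ ψ : G → ℝ} (hφ : IsCondNegDef φ) (hψ : IsCondNegDef ψ) :
    IsCondNegDef (φ + ψ) where
  map_one := by simp [hφ.map_one, hψ.map_one]
  map_inv g := by simp [hφ.map_inv, hψ.map_inv]
  sum_nonpos n g c hc := by
    simp only [Pi.add_apply, mul_add, Finset.sum_add_distrib]
    exact add_nonpos (hφ.sum_nonpos n g c hc) (hψ.sum_nonpos n g c hc)

lemma sum {G ι : Type*} [Group G] {φ : ι → G → ℝ} (s : Finset ι) (h : ∀ i, IsCondNegDef (φ i)) :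
    IsCondNegDef (∑ i ∈ s, φ i) := by
  classical
  induction s using Finset.induction_on with
  | empty => exact ⟨by simp, by simp, by simp⟩
  | insert i s hi ih => rw [Finset.sum_insert hi]; exact (h i).add ih

open Classical in
lemma indicator_ne_one (G : Type*) [Group G] :
    IsCondNegDef (fun g : G => if g = 1 then (0 : ℝ) else 1) where
  map_one := by simp
  map_inv g := by simp
  sum_nonpos n g c hc := by
    -- With `s x` the sum of the `c i` such that `g i = x`, the sum is `(∑ c i) ^ 2 - ∑ x, s x ^ 2`.
    have h1 : ∀ i j, c i * c j * (if (g j)⁻¹ * g i = 1 then (0 : ℝ) else 1) =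
        c i * c j - ∑ x ∈ Finset.univ.image g,
          (if g i = x then c i else 0) * (if g j = x then c j else 0) := by
      intro i j
      have h2 : ∀ x ∈ Finset.univ.image g,
          (if g i = x then c i else 0) * (if g j = x then c j else 0) =
            if g i = x then c i * (if g j = g i then c j else 0) else 0 := by
        intro x _
        by_cases h : g i = x
        · subst h; simp
        · simp [h]
      rw [Finset.sum_congr rfl h2, Finset.sum_ite_eq,
        if_pos (Finset.mem_image_of_mem g (Finset.mem_univ i)), inv_mul_eq_one]
      by_cases h : g j = g i <;> simp [h]
    have h3 : ∑ i, ∑ j, ∑ x ∈ Finset.univ.image g,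
          (if g i = x then c i else 0) * (if g j = x then c j else 0) =
        ∑ x ∈ Finset.univ.image g, (∑ i, if g i = x then c i else 0) ^ 2 := by
      simp only [sq, Finset.sum_mul_sum]
      exact ((Finset.sum_congr rfl fun i _ => Finset.sum_comm).trans Finset.sum_comm)
    have h4 : ∑ i, ∑ j, c i * c j = 0 := by simp only [← Finset.mul_sum, hc, mul_zero,
      Finset.sum_const_zero]
    simp only [h1, Finset.sum_sub_distrib]
    rw [h3, h4, zero_sub]
    exact neg_nonpos.2 (Finset.sum_nonneg fun x _ => sq_nonneg _)

end IsCondNegDef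

noncomputable section

namespace IsCondNegDef

variable {H : Type*} [Group H] {φ : H → ℝ}

lemma sum_finset_nonpos (hφ : IsCondNegDef φ) (s : Finset H) (f : H → ℝ)
    (hf : ∑ x ∈ s, f x = 0) : ∑ x ∈ s, ∑ y ∈ s, f x * f y * φ (y⁻¹ * x) ≤ 0 := by
  have h := hφ.sum_nonpos s.card (fun i => s.equivFin.symm i) (fun i => f (s.equivFin.symm i))
    (by rw [s.equivFin.symm.sum_comp (fun x : s => f x), Finset.sum_coe_sort s f, hf])
  have h2 : ∀ x : H, ∑ j, f x * f (s.equivFin.symm j) * φ ((s.equivFin.symm j : H)⁻¹ * x) =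
      ∑ y ∈ s, f x * f y * φ (y⁻¹ * x) := fun x => by
    rw [s.equivFin.symm.sum_comp (fun y : s => f x * f y * φ ((y : H)⁻¹ * x)),
      Finset.sum_coe_sort s (fun y => f x * f y * φ (y⁻¹ * x))]
  simp only [h2] at h
  rwa [s.equivFin.symm.sum_comp (fun x : s => ∑ y ∈ s, f x * f y * φ (y⁻¹ * x)),
    Finset.sum_coe_sort s (fun x => ∑ y ∈ s, f x * f y * φ (y⁻¹ * x))] at h

end IsCondNegDef
/-- The finitely supported real functions on `H` with sum zero. -/
abbrev SumZero (H : Type*) : Submodule ℝ (H →₀ ℝ) :=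
  LinearMap.ker (Finsupp.linearCombination ℝ (fun _ : H => (1 : ℝ)))

/-- The bilinear form on finitely supported functions with Gram matrix `K` on the point masses. -/
def kernelForm {H : Type*} (K : H → H → ℝ) :
    (H →₀ ℝ) →ₗ[ℝ] (H →₀ ℝ) →ₗ[ℝ] ℝ :=
  Finsupp.linearCombination ℝ fun x => Finsupp.linearCombination ℝ (K x)

lemma kernelForm_single {H : Type*} (K : H → H → ℝ) (x y : H) (a b : ℝ) :
    kernelForm K (Finsupp.single x a) (Finsupp.single y b) = a * (b * K x y) := by
  simp [kernelForm]

lemma kernelForm_apply {H : Type*} (K : H → H → ℝ) (f g : H →₀ ℝ) :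
    kernelForm K f g = ∑ x ∈ f.support, ∑ y ∈ g.support, f x * (g y * K x y) := by
  simp [kernelForm, Finsupp.linearCombination_apply, Finsupp.sum, LinearMap.sum_apply,
    Finset.mul_sum]

lemma kernelForm_symm {H : Type*} (K : H → H → ℝ) (hK : ∀ x y, K x y = K y x) (f g : H →₀ ℝ) :
    kernelForm K f g = kernelForm K g f := by
  rw [kernelForm_apply, kernelForm_apply, Finset.sum_comm]
  refine Finset.sum_congr rfl fun x _ => Finset.sum_congr rfl fun y _ => ?_
  rw [hK]; ring

lemma kernelForm_mapDomain {H : Type*} (K : H → H → ℝ) (s : H → H)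
    (hK : ∀ x y, K (s x) (s y) = K x y) (f g : H →₀ ℝ) :
    kernelForm K (f.mapDomain s) (g.mapDomain s) = kernelForm K f g := by
  have : (kernelForm K).compl₁₂ (Finsupp.lmapDomain ℝ ℝ s) (Finsupp.lmapDomain ℝ ℝ s) =
      kernelForm K := by
    refine Finsupp.lhom_ext fun x a => Finsupp.lhom_ext fun y b => ?_
    simp only [LinearMap.compl₁₂_apply, Finsupp.lmapDomain_apply, Finsupp.mapDomain_single,
      kernelForm_single, hK]
  exact LinearMap.congr_fun₂ this f g

/-- The cocycle `g ↦ δ_g - δ_1` with values in the functions of sum zero, for the representation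
by translations and the form with kernel `-φ (y⁻¹ * x) / 2`. Positivity of this form on functions
of sum zero is the conditional negativity of `φ`. -/
def IsCondNegDef.cocycle {H : Type*} [Group H] {φ : H → ℝ} (hφ : IsCondNegDef φ) :
    OrthogonalCocycle H (SumZero H) where
  form := (kernelForm fun x y => -(φ (y⁻¹ * x)) / 2).domRestrict₁₂ (SumZero H) (SumZero H)
  form_symm f g := kernelForm_symm _ (fun x y => by
    rw [← hφ.map_inv (y⁻¹ * x), mul_inv_rev, inv_inv]) _ _
  form_nonneg f := by
    have hf : ∑ x ∈ f.1.support, f.1 x = 0 := by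
      simpa only [LinearMap.mem_ker, Finsupp.linearCombination_apply, Finsupp.sum, smul_eq_mul,
        mul_one] using f.2
    have h := hφ.sum_finset_nonpos f.1.support f.1 hf
    have h2 : kernelForm (fun x y => -(φ (y⁻¹ * x)) / 2) f.1 f.1 =
        -(∑ x ∈ f.1.support, ∑ y ∈ f.1.support, f.1 x * f.1 y * φ (y⁻¹ * x)) / 2 := by
      rw [kernelForm_apply, ← Finset.sum_neg_distrib, Finset.sum_div]
      refine Finset.sum_congr rfl fun x _ => ?_
      rw [← Finset.sum_neg_distrib, Finset.sum_div]
      exact Finset.sum_congr rfl fun y _ => by ring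
    change 0 ≤ kernelForm (fun x y => -(φ (y⁻¹ * x)) / 2) f.1 f.1
    rw [h2]
    linarith
  rep :=
    { toFun g := (Finsupp.lmapDomain ℝ ℝ (g * ·)).restrict (p := SumZero H) (q := SumZero H)
        fun f hf => by
          simpa [Finsupp.linearCombination_mapDomain, Function.comp_def] using hf
      map_one' := by
        ext f : 2
        simp only [one_mul]
        exact Finsupp.mapDomain_id
      map_mul' g h := by
        ext f : 2
        simp only [LinearMap.coe_restrict_apply, Module.End.mul_apply, Finsupp.lmapDomain_apply,
          ← Finsupp.mapDomain_comp]
        simp [Function.comp_def, mul_assoc] }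
  form_rep g f f' := kernelForm_mapDomain _ _ (fun x y => by simp [mul_assoc]) _ _
  toFun g := ⟨Finsupp.single g 1 - Finsupp.single 1 1, by simp⟩
  map_mul g h := by
    ext1
    simp [Finsupp.mapDomain_sub]

lemma IsCondNegDef.sqNorm_cocycle {H : Type*} [Group H] {φ : H → ℝ} (hφ : IsCondNegDef φ) (g : H) :
    hφ.cocycle.sqNorm g = φ g := by
  change kernelForm (fun x y => -(φ (y⁻¹ * x)) / 2) (Finsupp.single g 1 - Finsupp.single 1 1)
    (Finsupp.single g 1 - Finsupp.single 1 1) = φ g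
  simp only [map_sub, LinearMap.sub_apply, kernelForm_single]
  simp [hφ.map_one, hφ.map_inv]
  ring


/-! ### Induced representations -/

section Induced

variable {G H C E : Type*} [Group G] [Group H] [MulAction G C] [AddCommGroup E] [Module ℝ E]

/-- The form on `C →₀ E` that makes the copies of `E` indexed by `C` orthogonal to each other and
equals `B` on each of them. -/
def inducedForm (C : Type*) (B : E →ₗ[ℝ] E →ₗ[ℝ] ℝ) : (C →₀ E) →ₗ[ℝ] (C →₀ E) →ₗ[ℝ] ℝ :=
  Finsupp.lsum ℝ fun c => (LinearMap.lcomp ℝ ℝ (Finsupp.lapply c)).comp B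

lemma inducedForm_apply (B : E →ₗ[ℝ] E →ₗ[ℝ] ℝ) (f g : C →₀ E) :
    inducedForm C B f g = f.sum fun c x => B x (g c) := by
  simp [inducedForm, Finsupp.sum, LinearMap.sum_apply]

lemma inducedForm_single (B : E →ₗ[ℝ] E →ₗ[ℝ] ℝ) (c : C) (x : E) (g : C →₀ E) :
    inducedForm C B (Finsupp.single c x) g = B x (g c) := by
  simp [inducedForm]

lemma inducedForm_symm (B : E →ₗ[ℝ] E →ₗ[ℝ] ℝ) (hB : ∀ x y, B x y = B y x) (f g : C →₀ E) :
    inducedForm C B f g = inducedForm C B g f := by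
  have : inducedForm C B = (inducedForm C B).flip := by
    refine Finsupp.lhom_ext fun c x => Finsupp.lhom_ext fun d y => ?_
    rw [LinearMap.flip_apply, inducedForm_single, inducedForm_single]
    by_cases h : d = c
    · subst h; simp [hB x y]
    · simp [Finsupp.single_eq_of_ne h, Finsupp.single_eq_of_ne (Ne.symm h)]
  exact LinearMap.congr_fun₂ this f g

lemma inducedForm_nonneg (B : E →ₗ[ℝ] E →ₗ[ℝ] ℝ) (hB : ∀ x, 0 ≤ B x x) (f : C →₀ E) :
    0 ≤ inducedForm C B f f := by
  rw [inducedForm_apply]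
  exact Finset.sum_nonneg fun c _ => hB _

/-- The representation of `G` on `C →₀ E` that permutes the copies of `E` by the action on `C` and
acts on `E` through `π : G →* H`. When `C` is the set of cosets of a subgroup `S`, it is the
representation induced from the representation `ρ ∘ π` of `S`. -/
def inducedRep (C : Type*) [MulAction G C] (π : G →* H) (ρ : H →* (E →ₗ[ℝ] E)) :
    G →* ((C →₀ E) →ₗ[ℝ] (C →₀ E)) where
  toFun g := Finsupp.lsum ℝ fun c => (Finsupp.lsingle (g • c)).comp (ρ (π g))
  map_one' := by
    refine Finsupp.lhom_ext fun c x => ?_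
    simp
  map_mul' g h := by
    refine Finsupp.lhom_ext fun c x => ?_
    simp [mul_smul]

@[simp]
lemma inducedRep_single (π : G →* H) (ρ : H →* (E →ₗ[ℝ] E)) (g : G) (c : C) (x : E) :
    inducedRep C π ρ g (Finsupp.single c x) = Finsupp.single (g • c) (ρ (π g) x) := by
  simp [inducedRep]

lemma inducedRep_apply (π : G →* H) (ρ : H →* (E →ₗ[ℝ] E)) (g : G) (f : C →₀ E) (c : C) :
    inducedRep C π ρ g f c = ρ (π g) (f (g⁻¹ • c)) := by
  have : (Finsupp.lapply c).comp (inducedRep C π ρ g) =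
      (ρ (π g)).comp (Finsupp.lapply (R := ℝ) (g⁻¹ • c)) := by
    refine Finsupp.lhom_ext fun d x => ?_
    simp only [LinearMap.comp_apply, inducedRep_single, Finsupp.lapply_apply]
    by_cases h : c = g • d
    · subst h; simp
    · have h' : g⁻¹ • c ≠ d := fun e => h (inv_smul_eq_iff.1 e)
      simp [Finsupp.single_eq_of_ne h, Finsupp.single_eq_of_ne h']
  exact LinearMap.congr_fun this f

lemma inducedForm_inducedRep (B : E →ₗ[ℝ] E →ₗ[ℝ] ℝ) (π : G →* H) (ρ : H →* (E →ₗ[ℝ] E))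
    (hB : ∀ h x y, B (ρ h x) (ρ h y) = B x y) (g : G) (f f' : C →₀ E) :
    inducedForm C B (inducedRep C π ρ g f) (inducedRep C π ρ g f') = inducedForm C B f f' := by
  have : (inducedForm C B).compl₁₂ (inducedRep C π ρ g) (inducedRep C π ρ g) =
      inducedForm C B := by
    refine Finsupp.lhom_ext fun c x => LinearMap.ext fun f' => ?_
    simp [inducedForm_single, inducedRep_apply, hB]
  exact LinearMap.congr_fun₂ this f f'

end Induced

/-! ### Graph products: universal property, retractions and stars -/

namespace GraphProduct

variable {V : Type w} {Γ : SimpleGraph V} {G : V → Type u} [∀ v, Group (G v)]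

variable (Γ) in
/-- The canonical homomorphism from a vertex group to the graph product. -/
def of {v : V} : G v →* GraphProduct Γ G :=
  (QuotientGroup.mk' _).comp Monoid.CoprodI.of

lemma of_mul_of_comm {v w : V} (h : Γ.Adj v w) (a : G v) (b : G w) :
    of Γ a * of Γ b = of Γ b * of Γ a := by
  have h1 : (QuotientGroup.mk (Monoid.CoprodI.of a * Monoid.CoprodI.of b *
      (Monoid.CoprodI.of a)⁻¹ * (Monoid.CoprodI.of b)⁻¹) : GraphProduct Γ G) = 1 :=
    (QuotientGroup.eq_one_iff _).2 (Subgroup.subset_normalClosure ⟨v, w, h, a, b, rfl⟩)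
  have h2 : of Γ a * of Γ b * (of Γ a)⁻¹ * (of Γ b)⁻¹ = 1 := h1
  rwa [mul_inv_eq_one, mul_inv_eq_iff_eq_mul] at h2

/-- Homomorphisms out of the vertex groups whose images commute for adjacent vertices extend to the
graph product. -/
def lift {M : Type*} [Monoid M] (F : ∀ v, G v →* M)
    (hF : ∀ v w, Γ.Adj v w → ∀ a b, F v a * F w b = F w b * F v a) : GraphProduct Γ G →* M :=
  QuotientGroup.lift _ (Monoid.CoprodI.lift F) <| Subgroup.normalClosure_le_normal <| by
    rintro _ ⟨v, w, h, a, b, rfl⟩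
    simp only [SetLike.mem_coe, MonoidHom.mem_ker, ← map_inv, map_mul, Monoid.CoprodI.lift_of]
    rw [hF v w h, mul_assoc (F w b), ← map_mul, mul_inv_cancel, _root_.map_one, mul_one,
      ← map_mul, mul_inv_cancel, _root_.map_one]

@[simp]
lemma lift_of {M : Type*} [Monoid M] (F : ∀ v, G v →* M)
    (hF : ∀ v w, Γ.Adj v w → ∀ a b, F v a * F w b = F w b * F v a) {v : V} (a : G v) :
    lift F hF (of Γ a) = F v a :=
  Monoid.CoprodI.lift_of ..

@[elab_as_elim]
lemma induction_on {p : GraphProduct Γ G → Prop} (g : GraphProduct Γ G) (one : p 1)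
    (of : ∀ v (a : G v), p (of Γ a)) (mul : ∀ x y, p x → p y → p (x * y)) : p g := by
  induction g using QuotientGroup.induction_on with
  | H x =>
    induction x using Monoid.CoprodI.induction_on with
    | one => exact one
    | of v a => exact of v a
    | mul x y hx hy => exact mul _ _ hx hy

open Classical in
/-- The retraction of the graph product onto `G v` that kills all other vertex groups. -/
def proj (v : V) : GraphProduct Γ G →* G v :=
  lift (fun w => if h : w = v then h ▸ MonoidHom.id (G w) else 1) <| by
    rintro u w h a b
    by_cases hu : u = v
    · have hw : w ≠ v := fun e => h.ne (hu.trans e.symm)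
      simp [hw]
    · simp [hu]

@[simp]
lemma proj_of_self {v : V} (a : G v) : proj v (of Γ a) = a := by
  simp [proj]

lemma proj_of_of_ne {v w : V} (h : w ≠ v) (a : G w) : proj v (of Γ a) = 1 := by
  simp [proj, h]

variable (Γ G) in
/-- The subgroup generated by the vertex groups of `v` and of its neighbours. -/
def star (v : V) : Subgroup (GraphProduct Γ G) :=
  Subgroup.closure {x | ∃ w, (w = v ∨ Γ.Adj v w) ∧ ∃ a : G w, x = of Γ a}

lemma of_mem_star {v w : V} (h : w = v ∨ Γ.Adj v w) (a : G w) : of Γ a ∈ star Γ G v :=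
  Subgroup.subset_closure ⟨w, h, a, rfl⟩

lemma of_smul_one_star {v w : V} (h : w = v ∨ Γ.Adj v w) (a : G w) :
    of Γ a • ((1 : GraphProduct Γ G) : GraphProduct Γ G ⧸ star Γ G v) = (1 : GraphProduct Γ G) := by
  rw [MulAction.Quotient.smul_coe, smul_eq_mul, mul_one, QuotientGroup.eq, mul_one]
  exact inv_mem (of_mem_star h a)
/-! ### The cocycle on the graph product induced from a vertex group -/

section Cocycle

variable {E : Type*} [AddCommGroup E] [Module ℝ E] {v : V}

variable (Γ G) in
/-- The coset of the identity, as a point of the cosets of `star v`. -/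
abbrev base (v : V) : GraphProduct Γ G ⧸ star Γ G v := ((1 : GraphProduct Γ G) : _ ⧸ star Γ G v)

variable (Γ) in
/-- The representation of the graph product induced from the representation of `star v` that is
obtained from `b.rep` through `proj v`. -/
abbrev cocycleRep (b : OrthogonalCocycle (G v) E) :
    GraphProduct Γ G →* (((GraphProduct Γ G ⧸ star Γ G v) →₀ E) →ₗ[ℝ]
      ((GraphProduct Γ G ⧸ star Γ G v) →₀ E)) :=
  inducedRep (GraphProduct Γ G ⧸ star Γ G v) (proj v) b.rep

variable (Γ) in
/-- The value at `of a`, with `a` in the vertex group of `w`, of the cocycle induced by `b`. It is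
`b a` at the base coset for `w = v`, and zero for `w ≠ v`, since then `proj v` kills `a`. -/
def syllableCocycle (b : OrthogonalCocycle (G v) E) {w : V} (a : G w) :
    (GraphProduct Γ G ⧸ star Γ G v) →₀ E :=
  Finsupp.single (base Γ G v) (b.toFun (proj v (of Γ a)))

lemma syllableCocycle_of_ne (b : OrthogonalCocycle (G v) E) {w : V} (h : w ≠ v) (a : G w) :
    syllableCocycle Γ b a = 0 := by
  simp [syllableCocycle, proj_of_of_ne h, b.map_one]

lemma syllableCocycle_mul (b : OrthogonalCocycle (G v) E) {w : V} (a a' : G w) :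
    syllableCocycle Γ b (a * a') =
      cocycleRep Γ b (of Γ a) (syllableCocycle Γ b a') + syllableCocycle Γ b a := by
  by_cases h : w = v
  · rw [syllableCocycle, syllableCocycle, inducedRep_single, of_smul_one_star (Or.inl h),
      syllableCocycle, ← Finsupp.single_add, map_mul, map_mul, b.map_mul, add_comm]
  · simp [syllableCocycle_of_ne b h]

lemma syllableCocycle_comm_aux (b : OrthogonalCocycle (G v) E) {w : V} (h : Γ.Adj v w)
    (a : G v) (a' : G w) :
    cocycleRep Γ b (of Γ a) (syllableCocycle Γ b a') + syllableCocycle Γ b a =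
      cocycleRep Γ b (of Γ a') (syllableCocycle Γ b a) + syllableCocycle Γ b a' := by
  rw [syllableCocycle_of_ne b h.ne', map_zero, zero_add, add_zero, syllableCocycle,
    inducedRep_single, of_smul_one_star (Or.inr h), proj_of_of_ne h.ne', map_one]
  rfl

/-- The compatibility of the syllable cocycles with the defining relations of the graph product. -/
lemma syllableCocycle_comm (b : OrthogonalCocycle (G v) E) {w w' : V} (h : Γ.Adj w w')
    (a : G w) (a' : G w') :
    cocycleRep Γ b (of Γ a) (syllableCocycle Γ b a') + syllableCocycle Γ b a =
      cocycleRep Γ b (of Γ a') (syllableCocycle Γ b a) + syllableCocycle Γ b a' := by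
  by_cases hw : w = v
  · subst hw; exact syllableCocycle_comm_aux b h a a'
  by_cases hw' : w' = v
  · subst hw'; exact (syllableCocycle_comm_aux b h.symm a' a).symm
  simp [syllableCocycle_of_ne b hw, syllableCocycle_of_ne b hw']

variable (Γ) in
/-- The affine action of the graph product whose linear part is `cocycleRep` and whose translation
part on the vertex groups is `syllableCocycle`. -/
def affineAction (b : OrthogonalCocycle (G v) E) :
    GraphProduct Γ G →* Function.End ((GraphProduct Γ G ⧸ star Γ G v) →₀ E) :=
  lift (fun w =>
    { toFun a := fun f => cocycleRep Γ b (of Γ a) f + syllableCocycle Γ b a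
      map_one' := by
        funext f
        simp only [map_one, syllableCocycle, b.map_one, Finsupp.single_zero, add_zero]
        rfl
      map_mul' a a' := by
        funext f
        change _ = cocycleRep Γ b (of Γ a) (cocycleRep Γ b (of Γ a') f + _) + _
        rw [map_mul, map_mul, Module.End.mul_apply, syllableCocycle_mul, map_add, add_assoc] }) <| by
    intro w w' h a a'
    funext f
    change cocycleRep Γ b (of Γ a) (cocycleRep Γ b (of Γ a') f + _) + _ =
      cocycleRep Γ b (of Γ a') (cocycleRep Γ b (of Γ a) f + _) + _
    rw [map_add, map_add, add_assoc, add_assoc, syllableCocycle_comm b h,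
      ← Module.End.mul_apply, ← Module.End.mul_apply, ← map_mul, ← map_mul, of_mul_of_comm h]

lemma affineAction_of (b : OrthogonalCocycle (G v) E) {w : V} (a : G w)
    (f : (GraphProduct Γ G ⧸ star Γ G v) →₀ E) :
    affineAction Γ b (of Γ a) f = cocycleRep Γ b (of Γ a) f + syllableCocycle Γ b a := by
  exact congrFun (lift_of (Γ := Γ) (M := Function.End _) _ _ a) f

lemma affineAction_mul (b : OrthogonalCocycle (G v) E) (g h : GraphProduct Γ G)
    (f : (GraphProduct Γ G ⧸ star Γ G v) →₀ E) :
    affineAction Γ b (g * h) f = affineAction Γ b g (affineAction Γ b h f) := by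
  rw [map_mul]
  rfl

lemma affineAction_apply (b : OrthogonalCocycle (G v) E) (g : GraphProduct Γ G)
    (f : (GraphProduct Γ G ⧸ star Γ G v) →₀ E) :
    affineAction Γ b g f = cocycleRep Γ b g f + affineAction Γ b g 0 := by
  induction g using induction_on generalizing f with
  | one => simp only [map_one]; exact (add_zero f).symm
  | of w a => rw [affineAction_of, affineAction_of, map_zero, zero_add]
  | mul x y hx hy =>
    rw [affineAction_mul, affineAction_mul, hx, hy, hx (affineAction Γ b y 0), map_add, map_mul,
      Module.End.mul_apply, add_assoc]

variable (Γ) in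
/-- The cocycle on the graph product that is `b`, placed at the base coset, on the vertex group
of `v`, and zero on the other vertex groups: the orbit of `0` under `affineAction`. -/
def cocycle (b : OrthogonalCocycle (G v) E) :
    OrthogonalCocycle (GraphProduct Γ G) ((GraphProduct Γ G ⧸ star Γ G v) →₀ E) where
  form := inducedForm _ b.form
  form_symm := inducedForm_symm _ b.form_symm
  form_nonneg := inducedForm_nonneg _ b.form_nonneg
  rep := cocycleRep Γ b
  form_rep := inducedForm_inducedRep _ _ _ b.form_rep
  toFun g := affineAction Γ b g 0
  map_mul g h := by rw [affineAction_mul, affineAction_apply, add_comm]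

lemma cocycle_of (b : OrthogonalCocycle (G v) E) {w : V} (a : G w) :
    (cocycle Γ b).toFun (of Γ a) = syllableCocycle Γ b a := by
  change affineAction Γ b (of Γ a) 0 = _
  rw [affineAction_of, map_zero, zero_add]

lemma cocycle_of_of_ne (b : OrthogonalCocycle (G v) E) {w : V} (h : w ≠ v) (a : G w) :
    (cocycle Γ b).toFun (of Γ a) = 0 := by
  rw [cocycle_of, syllableCocycle_of_ne b h]

lemma cocycle_of_self (b : OrthogonalCocycle (G v) E) (a : G v) :
    (cocycle Γ b).toFun (of Γ a) = Finsupp.single (base Γ G v) (b.toFun a) := by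
  rw [cocycle_of, syllableCocycle, proj_of_self]

lemma cocycle_eq_zero_of_mem_star (b : OrthogonalCocycle (G v) E) {u : V}
    (h : ¬(v = u ∨ Γ.Adj u v)) {x : GraphProduct Γ G} (hx : x ∈ star Γ G u) :
    (cocycle Γ b).toFun x = 0 := by
  induction hx using Subgroup.closure_induction with
  | mem x hx =>
    obtain ⟨w, hw, a, rfl⟩ := hx
    exact cocycle_of_of_ne b (fun e => h (e ▸ hw)) a
  | one => exact OrthogonalCocycle.map_one _
  | mul x y _ _ hx hy => rw [OrthogonalCocycle.map_mul, hx, hy, map_zero, add_zero]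
  | inv x _ hx =>
    have := (cocycle Γ b).map_mul x⁻¹ x
    rw [inv_mul_cancel, OrthogonalCocycle.map_one, hx, map_zero, add_zero] at this
    exact this.symm

lemma sqNorm_of_mul_of_ne (b : OrthogonalCocycle (G v) E) {w : V} (h : w ≠ v) (a : G w)
    (g : GraphProduct Γ G) :
    (cocycle Γ b).sqNorm (of Γ a * g) = (cocycle Γ b).sqNorm g := by
  rw [OrthogonalCocycle.sqNorm, OrthogonalCocycle.map_mul, cocycle_of_of_ne b h, zero_add,
    OrthogonalCocycle.form_rep]
  rfl

/-- If the cocycle vanishes at `g` on the base coset, then its value at `of a * g` is an orthogonal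
sum, because `of a` fixes the base coset. -/
lemma sqNorm_of_self_mul (b : OrthogonalCocycle (G v) E) (a : G v) (g : GraphProduct Γ G)
    (hg : (cocycle Γ b).toFun g (base Γ G v) = 0) :
    (cocycle Γ b).sqNorm (of Γ a * g) = b.sqNorm a + (cocycle Γ b).sqNorm g := by
  have h1 : (cocycle Γ b).form ((cocycle Γ b).toFun (of Γ a))
      ((cocycle Γ b).rep (of Γ a) ((cocycle Γ b).toFun g)) = 0 := by
    rw [cocycle_of_self]
    change inducedForm _ b.form _ (inducedRep _ (proj v) b.rep _ _) = 0
    rw [inducedForm_single, inducedRep_apply, ← map_inv, of_smul_one_star (Or.inl rfl), hg,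
      map_zero, map_zero]
  have h2 : (cocycle Γ b).form ((cocycle Γ b).toFun (of Γ a)) ((cocycle Γ b).toFun (of Γ a)) =
      b.sqNorm a := by
    rw [cocycle_of_self]
    change inducedForm _ b.form _ _ = _
    rw [inducedForm_single, Finsupp.single_eq_same]
    rfl
  rw [OrthogonalCocycle.sqNorm, OrthogonalCocycle.map_mul, map_add, map_add, LinearMap.add_apply,
    LinearMap.add_apply, h1, h2, (cocycle Γ b).form_symm, h1, OrthogonalCocycle.form_rep,
    add_zero, zero_add]
  rfl

end Cocycle

/-! ### Words of minimal length -/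

section Words

variable (Γ) in
/-- The element of the graph product represented by a word in the vertex groups. -/
def wordProd (l : List (Σ v, G v)) : GraphProduct Γ G := (l.map fun x => of Γ x.2).prod

@[simp] lemma wordProd_nil : wordProd Γ ([] : List (Σ v, G v)) = 1 := rfl

@[simp] lemma wordProd_cons (x : Σ v, G v) (l : List (Σ v, G v)) :
    wordProd Γ (x :: l) = of Γ x.2 * wordProd Γ l := by simp [wordProd]

@[simp] lemma wordProd_append (l l' : List (Σ v, G v)) :
    wordProd Γ (l ++ l') = wordProd Γ l * wordProd Γ l' := by simp [wordProd]

lemma exists_wordProd_eq (g : GraphProduct Γ G) : ∃ l, wordProd Γ l = g := by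
  induction g using induction_on with
  | one => exact ⟨[], rfl⟩
  | of v a => exact ⟨[⟨v, a⟩], by simp⟩
  | mul x y hx hy =>
    obtain ⟨l, rfl⟩ := hx
    obtain ⟨l', rfl⟩ := hy
    exact ⟨l ++ l', wordProd_append _ _⟩

variable (Γ) in
/-- A word is reduced if no shorter word represents the same element. -/
def IsReduced (l : List (Σ v, G v)) : Prop :=
  ∀ l', wordProd Γ l' = wordProd Γ l → l.length ≤ l'.length

lemma exists_isReduced (g : GraphProduct Γ G) : ∃ l, IsReduced Γ l ∧ wordProd Γ l = g := by
  classical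
  have h : ∃ n, ∃ l : List (Σ v, G v), l.length = n ∧ wordProd Γ l = g :=
    (exists_wordProd_eq g).imp' List.length fun l hl => ⟨l, rfl, hl⟩
  obtain ⟨l, hl, hg⟩ := Nat.find_spec h
  exact ⟨l, fun l' hl' => hl ▸ Nat.find_min' h ⟨l', rfl, hl'.trans hg⟩, hg⟩

lemma IsReduced.of_append {p l q : List (Σ v, G v)} (h : IsReduced Γ (p ++ l ++ q)) :
    IsReduced Γ l := fun l' hl' => by
  have := h (p ++ l' ++ q) (by simp [hl'])
  simp only [List.length_append] at this
  omega

lemma IsReduced.ne_one {l : List (Σ v, G v)} (h : IsReduced Γ l) {x : Σ v, G v} (hx : x ∈ l) :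
    x.2 ≠ 1 := by
  obtain ⟨p, q, rfl⟩ := List.append_of_mem hx
  intro e
  have := h (p ++ q) (by simp [e])
  simp at this

/-- Two letters from `G v` can be merged if all letters between them lie in the star of `v`. -/
lemma exists_length_le_of_star {v : V} (p : List (Σ v, G v)) (hp : ∀ x ∈ p, x.1 = v ∨ Γ.Adj v x.1)
    (a a' : G v) :
    ∃ l : List (Σ v, G v), l.length ≤ p.length + 1 ∧
      wordProd Γ l = of Γ a * wordProd Γ p * of Γ a' := by
  induction p generalizing a with
  | nil => exact ⟨[⟨v, a * a'⟩], by simp, by simp⟩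
  | cons x p ih =>
    have hp' := fun y hy => hp y (List.mem_cons_of_mem x hy)
    obtain ⟨w, x⟩ := x
    rcases hp ⟨w, x⟩ List.mem_cons_self with h | h
    · obtain rfl : w = v := h
      obtain ⟨l, hl, hl'⟩ := ih hp' (a * x)
      exact ⟨l, by simp only [List.length_cons]; omega, by simp [hl', mul_assoc]⟩
    · obtain ⟨l, hl, hl'⟩ := ih hp' a
      refine ⟨⟨w, x⟩ :: l, by simpa using hl, ?_⟩
      rw [wordProd_cons, hl', wordProd_cons, ← mul_assoc, ← mul_assoc, ← mul_assoc,
        of_mul_of_comm h]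

lemma IsReduced.exists_exists_not_star {v : V} {p q : List (Σ v, G v)} {a a' : G v}
    (h : IsReduced Γ (⟨v, a⟩ :: (p ++ ⟨v, a'⟩ :: q))) : ∃ x ∈ p, ¬(x.1 = v ∨ Γ.Adj v x.1) := by
  by_contra! hp
  obtain ⟨l, hl, hl'⟩ := exists_length_le_of_star p (fun x hx => by have := hp x hx; tauto) a a'
  have := h (l ++ q) (by simp [hl', mul_assoc])
  simp only [List.length_append, List.length_cons] at this
  omega

/-- The cocycle of `v` at a word is supported on the cosets of the prefixes that are followed by a
letter from `G v`. -/
lemma exists_of_cocycle_wordProd_ne_zero {E : Type*} [AddCommGroup E] [Module ℝ E] {v : V}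
    (b : OrthogonalCocycle (G v) E) (l : List (Σ v, G v)) (c : GraphProduct Γ G ⧸ star Γ G v)
    (h : (cocycle Γ b).toFun (wordProd Γ l) c ≠ 0) :
    ∃ p a q, l = p ++ ⟨v, a⟩ :: q ∧ c = (wordProd Γ p : GraphProduct Γ G ⧸ star Γ G v) := by
  induction l generalizing c with
  | nil => simp [OrthogonalCocycle.map_one] at h
  | cons x t ih =>
    obtain ⟨w, x⟩ := x
    by_cases hx : (cocycle Γ b).toFun (of Γ x) c = 0
    · rw [wordProd_cons, OrthogonalCocycle.map_mul, Finsupp.add_apply, hx, zero_add] at h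
      change inducedRep _ (proj v) b.rep _ _ c ≠ 0 at h
      rw [inducedRep_apply] at h
      obtain ⟨p, a, q, rfl, hc⟩ := ih _ fun e => h (by rw [e, map_zero])
      refine ⟨⟨w, x⟩ :: p, a, q, rfl, ?_⟩
      rw [inv_smul_eq_iff] at hc
      rw [hc, wordProd_cons]
      rfl
    · obtain rfl : w = v := by
        by_contra hw
        simp [cocycle_of_of_ne b hw] at hx
      rw [cocycle_of_self] at hx
      refine ⟨[], x, t, rfl, ?_⟩
      by_contra hc
      exact hx (Finsupp.single_eq_of_ne hc)

/-- On a reduced word the squared norm of the cocycle of `v` is the sum of the squared norms over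
the letters from `G v`; the other letters contribute `0`, being killed by `proj v`. -/
theorem IsReduced.sqNorm_cocycle {E : V → Type*} [∀ v, AddCommGroup (E v)] [∀ v, Module ℝ (E v)]
    (b : ∀ v, OrthogonalCocycle (G v) (E v)) (hb : ∀ v (a : G v), a ≠ 1 → 0 < (b v).sqNorm a)
    {l : List (Σ v, G v)} (hl : IsReduced Γ l) (v : V) :
    (cocycle Γ (b v)).sqNorm (wordProd Γ l) =
      (l.map fun x => (b v).sqNorm (proj v (of Γ x.2))).sum := by
  induction hn : l.length using Nat.strong_induction_on generalizing l v with
  | h n ih =>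
    subst hn
    cases l with
    | nil => simp [OrthogonalCocycle.sqNorm, OrthogonalCocycle.map_one]
    | cons x t =>
      obtain ⟨w, x⟩ := x
      have ht : IsReduced Γ t := IsReduced.of_append (p := [⟨w, x⟩]) (q := []) (by simpa using hl)
      rw [wordProd_cons, List.map_cons, List.sum_cons, ← ih _ (by simp) ht v rfl]
      by_cases hw : w = v
      · subst hw
        rw [proj_of_self]
        apply sqNorm_of_self_mul
        -- Otherwise some prefix `p` of the rest, followed by a letter from `G w`, represents an
        -- element of `star w`. But `p` has a letter `y` outside the star of `w`, so that the
        -- cocycle of the vertex of `y` is nonzero on `p` by induction, and zero on `star w`.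
        by_contra h0
        obtain ⟨p, a, q, rfl, hp⟩ := exists_of_cocycle_wordProd_ne_zero _ _ _ h0
        have hp' : wordProd Γ p ∈ star Γ G w := by
          rw [QuotientGroup.eq] at hp
          simpa using hp
        obtain ⟨y, hy, hyw⟩ := hl.exists_exists_not_star
        have hpr : IsReduced Γ p := IsReduced.of_append (p := []) (by simpa using ht)
        have h1 := ih p.length (by simp) hpr y.1 rfl
        rw [OrthogonalCocycle.sqNorm, cocycle_eq_zero_of_mem_star _ hyw hp', map_zero] at h1
        have h2 := List.single_le_sum (l := p.map fun x => (b y.1).sqNorm (proj y.1 (of Γ x.2)))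
          (by simp only [List.mem_map]; rintro _ ⟨z, _, rfl⟩; exact (b y.1).sqNorm_nonneg _)
          _ (List.mem_map_of_mem hy)
        rw [← h1, proj_of_self] at h2
        exact absurd (hb _ _ (hpr.ne_one hy)) (not_lt.2 h2)
      · rw [sqNorm_of_mul_of_ne _ hw, proj_of_of_ne hw]
        simp [OrthogonalCocycle.sqNorm, OrthogonalCocycle.map_one]

/-- The sum over all vertices of the squared norms adds up over the letters of a reduced word. -/
theorem IsReduced.sum_sqNorm_cocycle [Fintype V] {E : V → Type*} [∀ v, AddCommGroup (E v)]
    [∀ v, Module ℝ (E v)] (b : ∀ v, OrthogonalCocycle (G v) (E v))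
    (hb : ∀ v (a : G v), a ≠ 1 → 0 < (b v).sqNorm a)
    {l : List (Σ v, G v)} (hl : IsReduced Γ l) :
    ∑ v, (cocycle Γ (b v)).sqNorm (wordProd Γ l) =
      (l.map fun x => (b x.1).sqNorm x.2).sum := by
  simp only [hl.sqNorm_cocycle b hb]
  clear hl
  induction l with
  | nil => simp
  | cons x t ih =>
    simp only [List.map_cons, List.sum_cons, Finset.sum_add_distrib, ih, add_left_inj]
    rw [Finset.sum_eq_single x.1 (fun v _ hv => ?_) (by simp), proj_of_self]
    rw [proj_of_of_ne hv.symm, OrthogonalCocycle.sqNorm, OrthogonalCocycle.map_one, map_zero]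

end Words

end GraphProduct
end

/-! ### Properness -/

lemma List.finite_setOf_length_le_of_forall_mem {α : Type*} {S : Set α} (hS : S.Finite) (n : ℕ) :
    {l : List α | l.length ≤ n ∧ ∀ x ∈ l, x ∈ S}.Finite := by
  have := hS.to_subtype
  refine ((List.finite_length_le S n).image (List.map Subtype.val)).subset ?_
  rintro l ⟨hl, h⟩
  lift l to List S using h
  exact ⟨l, by simpa using hl, rfl⟩

theorem theorem1 {V : Type w} [Finite V] (Γ : SimpleGraph V) (G : V → Type u)
    [∀ v, Group (G v)] (hG : ∀ v, HaagerupProperty (G v)) :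
    HaagerupProperty (GraphProduct Γ G) := by
  classical
  have := Fintype.ofFinite V
  choose φ hφ hφt using hG
  -- Adding the indicator of the nontrivial elements makes every nontrivial letter count at least `1`.
  have hψ := fun v => (hφ v).add (IsCondNegDef.indicator_ne_one (G v))
  set b := fun v => (hψ v).cocycle
  have hbφ : ∀ v a, φ v a ≤ (b v).sqNorm a := fun v a => by
    rw [IsCondNegDef.sqNorm_cocycle, Pi.add_apply]
    split_ifs <;> simp
  have hb1 : ∀ v a, a ≠ 1 → 1 ≤ (b v).sqNorm a := fun v a ha => by
    have h0 : 0 ≤ φ v a := (hφ v).sqNorm_cocycle a ▸ (hφ v).cocycle.sqNorm_nonneg a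
    rw [IsCondNegDef.sqNorm_cocycle, Pi.add_apply, if_neg ha]
    linarith
  refine ⟨∑ v, (GraphProduct.cocycle Γ (b v)).sqNorm,
    IsCondNegDef.sum _ fun v => OrthogonalCocycle.isCondNegDef_sqNorm _,
    tendsto_atTop.2 fun r => ?_⟩
  have hS : {x : Σ v, G v | (b x.1).sqNorm x.2 < r}.Finite := by
    refine (Set.finite_iUnion fun v =>
      (((tendsto_atTop.1 (hφt v) r) : {a | ¬ r ≤ φ v a}.Finite).image (Sigma.mk v))).subset ?_
    rintro ⟨v, a⟩ ha
    exact Set.mem_iUnion.2 ⟨v, a, not_le.2 ((hbφ v a).trans_lt ha), rfl⟩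
  refine ((List.finite_setOf_length_le_of_forall_mem hS ⌈r⌉₊).image
    (GraphProduct.wordProd Γ)).subset fun g hg => ?_
  obtain ⟨l, hl, rfl⟩ := GraphProduct.exists_isReduced g
  have hsum := hl.sum_sqNorm_cocycle b fun v a ha => one_pos.trans_le (hb1 v a ha)
  have hlt : (l.map fun x => (b x.1).sqNorm x.2).sum < r := by
    rw [← hsum, ← Finset.sum_apply]
    exact not_le.1 hg
  refine ⟨l, ⟨?_, fun x hx => ?_⟩, rfl⟩
  · have h1 := List.card_nsmul_le_sum (l.map fun x => (b x.1).sqNorm x.2) 1 (by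
      simp only [List.mem_map]
      rintro _ ⟨x, hx, rfl⟩
      exact hb1 _ _ (hl.ne_one hx))
    rw [List.length_map, nsmul_one] at h1
    exact_mod_cast (h1.trans hlt.le).trans (Nat.le_ceil r)
  · refine lt_of_le_of_lt (List.single_le_sum ?_ _ (List.mem_map_of_mem hx)) hlt
    simp only [List.mem_map]
    rintro _ ⟨z, _, rfl⟩
    exact OrthogonalCocycle.sqNorm_nonneg _ _
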